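/- For every integer $r \ge 0$ there is a constant $C_r$, depending only on $r$, such that the following holds for every integer $n \ge 1$. Let $X_1, \dots, X_r$ be independent random vectors, each distributed uniformly over the Euclidean unit sphere $\mathbb{S}^{n-1}(1) = \{x \in \mathbb{R}^n : \|x\| = 1\}$. Let $Q_{ij} = \sqrt{n}\,\langle X_i, X_j\rangle$ for $1 \le i < j \le r$, and let $P_{\mathbf Q}$ be the distribution of $\mathbf{Q} = (Q_{ij} : 1 \le i < j \le r)$, a random vector in $\mathbb{R}^{r(r-1)/2}$. Then $$\mathrm{TV}\bigl(P_{\mathbf Q}, \mathcal{N}(0, I_{r(r-1)/2})\bigr) \le \frac{C_r}{\sqrt{n}},$$ where $\mathcal{N}(0, I_d)$ is the standard Gaussian distribution on $\mathbb{R}^d$ and $\mathrm{TV}(\mu,\nu) = \sup_D |\mu(D) - \nu(D)|$, the supremum being over all measurable sets $D$. -/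

import Mathlib

open MeasureTheory ProbabilityTheory

/-- The total variation distance `sup_D |μ(D) - ν(D)|`, over measurable sets `D`, of two finite
measures. -/
noncomputable def tvDist {α : Type*} [MeasurableSpace α] (μ ν : Measure α) : ℝ :=
  ⨆ D : {D : Set α // MeasurableSet D}, |μ.real D - ν.real D|

/-- The uniform probability distribution on the Euclidean unit sphere of `ℝⁿ` (for `n ≥ 1`),
as a measure on `ℝⁿ`: the normalized surface measure. -/
noncomputable def sphereUniform (n : ℕ) : Measure (EuclideanSpace ℝ (Fin n)) :=
  (((volume : Measure (EuclideanSpace ℝ (Fin n))).toSphere Set.univ)⁻¹ •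
    (volume : Measure (EuclideanSpace ℝ (Fin n))).toSphere).map Subtype.val

/-- The index set of the pairs `i < j` in `{1, …, r}`. -/
abbrev OrderedPair (r : ℕ) : Type := {p : Fin r × Fin r // p.1 < p.2}

/-- The vector `(√n ⟨x_i, x_j⟩ : i < j)` of scaled pairwise inner products of `x_1, …, x_r ∈ ℝⁿ`. -/
noncomputable def scaledInnerProducts {r n : ℕ} (x : Fin r → EuclideanSpace ℝ (Fin n)) :
    EuclideanSpace ℝ (OrderedPair r) :=
  WithLp.toLp 2 fun p => √(n : ℝ) * inner ℝ (x p.1.1) (x p.1.2)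

open scoped ENNReal Matrix

/-! Induct on `r`, revealing the vectors one at a time. Given unit vectors `x₁, …, x_k`,
Gram–Schmidt writes them in an orthonormal basis through a lower triangular `L` with `L Lᵀ` their
Gram matrix. A uniform point on the sphere is `Z/‖Z‖` with `Z = (z, w)` Gaussian in this basis, so
its row of scaled inner products is `L` applied to `√n z / √(‖z‖² + ‖w‖²)`. For fixed `w` this is an
explicit function of the Gaussian `z`, and it distorts the Gaussian law only slightly: `‖w‖²/n - 1`
and the entries of `L Lᵀ - 1` both have mean absolute value of order `1/√n`.

Each distortion is measured by a change of variables along the inverse map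
(`stdGaussian_le_image_add`), applied to the radial map in
`stdGaussian_le_preimage_radialContraction_add` and to `L` in `stdGaussian_le_preimage_matrix_add`.
`stdGaussian_le_innerRow_add` combines them for one row, and
`stdGaussian_le_map_scaledInnerProducts_add` runs the induction. Only bounds `γ(D) ≤ μ(D) + ε` are
ever proved, so Jacobians and densities need only lower bounds. -/

/-! ### One-sided comparison of measures. -/

/-- For probability measures, the bound on `Dᶜ` is the reverse bound on `D`. -/
theorem tvDist_le_of_forall_le_add {α : Type*} [MeasurableSpace α] {μ ν : Measure α}
    [IsProbabilityMeasure μ] [IsProbabilityMeasure ν] {ε : ℝ} (hε : 0 ≤ ε)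
    (h : ∀ D, MeasurableSet D → ν D ≤ μ D + ENNReal.ofReal ε) : tvDist μ ν ≤ ε := by
  have key : ∀ D, MeasurableSet D → ν.real D ≤ μ.real D + ε := by
    intro D hD
    have := ENNReal.toReal_mono (by finiteness) (h D hD)
    rwa [ENNReal.toReal_add (by finiteness) (by finiteness), ENNReal.toReal_ofReal hε] at this
  have : Nonempty {D : Set α // MeasurableSet D} := ⟨⟨∅, .empty⟩⟩
  refine ciSup_le fun D => ?_
  have h₁ := key D D.2
  have h₂ := key (D : Set α)ᶜ D.2.compl
  rw [probReal_compl_eq_one_sub D.2, probReal_compl_eq_one_sub D.2] at h₂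
  rw [abs_le]
  constructor <;> linarith

/-- Layer-cake formula: the superlevel sets of `f` matter only for levels in `(0, 1]`, an interval
of length 1, so the error stays `ε`. In the induction `f` is a conditional probability. -/
theorem lintegral_le_lintegral_add_of_forall_le_add {α : Type*} [MeasurableSpace α]
    {μ ν : Measure α} {ε : ℝ≥0∞} (h : ∀ D, MeasurableSet D → ν D ≤ μ D + ε)
    {f : α → ℝ≥0∞} (hf : Measurable f) (hf1 : ∀ x, f x ≤ 1) :
    ∫⁻ x, f x ∂ν ≤ ∫⁻ x, f x ∂μ + ε := by
  have layer : ∀ κ : Measure α,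
      ∫⁻ x, f x ∂κ = ∫⁻ t in Set.Ioc (0 : ℝ) 1, κ {x | t < (f x).toReal} := by
    intro κ
    have h₁ : ∫⁻ x, f x ∂κ = ∫⁻ x, ENNReal.ofReal (f x).toReal ∂κ :=
      lintegral_congr fun x =>
        (ENNReal.ofReal_toReal ((hf1 x).trans_lt ENNReal.one_lt_top).ne).symm
    rw [h₁, lintegral_eq_lintegral_meas_lt κ (Filter.Eventually.of_forall fun x =>
      ENNReal.toReal_nonneg) hf.ennreal_toReal.aemeasurable,
      ← Set.Ioc_union_Ioi_eq_Ioi (zero_le_one' ℝ), lintegral_union measurableSet_Ioi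
        (Set.disjoint_left.2 fun t ht ht' => absurd ht.2 (not_le.2 ht'))]
    have h₂ : ∫⁻ t in Set.Ioi (1 : ℝ), κ {x | t < (f x).toReal} = 0 := by
      rw [setLIntegral_congr_fun (g := fun _ => 0) measurableSet_Ioi]
      · simp
      · intro t ht
        have : {x | t < (f x).toReal} = ∅ := by
          refine Set.eq_empty_of_forall_notMem fun x hx => ?_
          have := ENNReal.toReal_mono ENNReal.one_ne_top (hf1 x)
          simp only [ENNReal.toReal_one] at this
          exact absurd (lt_of_lt_of_le hx this) (not_lt.2 (le_of_lt ht))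
        simp [this]
    rw [h₂, add_zero]
  rw [layer μ, layer ν]
  calc ∫⁻ t in Set.Ioc (0 : ℝ) 1, ν {x | t < (f x).toReal}
      ≤ ∫⁻ t in Set.Ioc (0 : ℝ) 1, (μ {x | t < (f x).toReal} + ε) :=
        lintegral_mono fun t => h _ (measurableSet_lt measurable_const hf.ennreal_toReal)
    _ = _ := by
        rw [lintegral_add_right _ measurable_const]
        simp

theorem pi_withDensity_ofReal {ι : Type*} [Fintype ι] {μ : Measure ℝ} [SigmaFinite μ] {f : ℝ → ℝ}
    (hf : Integrable f μ) (hf0 : ∀ x, 0 ≤ f x) [SigmaFinite (μ.withDensity fun x => .ofReal (f x))] :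
    Measure.pi (fun _ : ι => μ.withDensity fun x => .ofReal (f x)) =
      (Measure.pi fun _ : ι => μ).withDensity fun x => .ofReal (∏ i, f (x i)) := by
  refine Measure.pi_eq fun s hs => ?_
  rw [withDensity_apply _ (MeasurableSet.univ_pi hs), Measure.restrict_pi_pi,
    ← ofReal_integral_eq_lintegral_ofReal, integral_fintype_prod_eq_prod (fun _ => f),
    ENNReal.ofReal_prod_of_nonneg fun i _ => integral_nonneg hf0]
  · refine Finset.prod_congr rfl fun i _ => ?_
    rw [withDensity_apply _ (hs i), ofReal_integral_eq_lintegral_ofReal hf.restrict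
      (Filter.Eventually.of_forall hf0)]
  · exact Integrable.fintype_prod fun i => hf.restrict
  · exact Filter.Eventually.of_forall fun x => Finset.prod_nonneg fun i _ => hf0 _

/-! ### Gaussian density and change of variables. -/

section Density

variable {ι : Type*} [Fintype ι]

/-- The density of the standard Gaussian distribution on `EuclideanSpace ℝ ι`. -/
noncomputable def stdGaussianPDF (x : EuclideanSpace ℝ ι) : ℝ≥0∞ :=
  ENNReal.ofReal ((√(2 * Real.pi))⁻¹ ^ Fintype.card ι * Real.exp (-(‖x‖ ^ 2 / 2)))

theorem measurable_stdGaussianPDF : Measurable (stdGaussianPDF (ι := ι)) := by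
  unfold stdGaussianPDF
  fun_prop

theorem stdGaussian_eq_withDensity :
    stdGaussian (EuclideanSpace ℝ ι) = volume.withDensity stdGaussianPDF := by
  have h : gaussianReal 0 1 = volume.withDensity fun x => .ofReal (gaussianPDFReal 0 1 x) := by
    rw [gaussianReal_of_var_ne_zero _ one_ne_zero]; rfl
  have : SigmaFinite (volume.withDensity fun x => .ofReal (gaussianPDFReal 0 1 x)) := by
    rw [← h]; infer_instance
  rw [← map_pi_eq_stdGaussian, h, pi_withDensity_ofReal (integrable_gaussianPDFReal 0 1)
    (gaussianPDFReal_nonneg 0 1), ← volume_pi]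
  ext s hs
  have hmp := PiLp.volume_preserving_toLp ι
  rw [Measure.map_apply hmp.measurable hs, withDensity_apply _ (hmp.measurable hs),
    withDensity_apply _ hs, ← hmp.setLIntegral_comp_preimage hs measurable_stdGaussianPDF]
  refine lintegral_congr fun x => ?_
  simp only [stdGaussianPDF, gaussianPDFReal, EuclideanSpace.real_norm_sq_eq]
  rw [Finset.prod_mul_distrib, ← Real.exp_sum]
  simp [Finset.sum_div, neg_div]

/-- The hypothesis `hle` says that the Gaussian density pulled back along `h`, Jacobian included, is
at least `1 - ε` times the density itself. To push the Gaussian forward by a map `T`, take `h` a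
right inverse of `T` on `S`: then `h '' (D ∩ S) ⊆ T ⁻¹' D`. -/
theorem stdGaussian_le_image_add {S : Set (EuclideanSpace ℝ ι)} (hS : MeasurableSet S)
    {h : EuclideanSpace ℝ ι → EuclideanSpace ℝ ι}
    {h' : EuclideanSpace ℝ ι → EuclideanSpace ℝ ι →L[ℝ] EuclideanSpace ℝ ι}
    (hh' : ∀ y ∈ S, HasFDerivAt h (h' y) y) (hinj : Set.InjOn h S)
    {ε : EuclideanSpace ℝ ι → ℝ≥0∞} (hε : Measurable ε)
    (hle : ∀ y ∈ S,
      1 ≤ ENNReal.ofReal (Real.exp ((‖y‖ ^ 2 - ‖h y‖ ^ 2) / 2) * |(h' y).det|) + ε y)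
    {D : Set (EuclideanSpace ℝ ι)} (hD : MeasurableSet D) :
    stdGaussian (EuclideanSpace ℝ ι) D ≤ stdGaussian (EuclideanSpace ℝ ι) (h '' (D ∩ S)) +
      (stdGaussian (EuclideanSpace ℝ ι) Sᶜ + ∫⁻ y, ε y ∂stdGaussian (EuclideanSpace ℝ ι)) := by
  have hDS := hD.inter hS
  have hd : ∀ y ∈ D ∩ S, HasFDerivWithinAt h (h' y) (D ∩ S) y :=
    fun y hy => (hh' y hy.2).hasFDerivWithinAt
  have hi : Set.InjOn h (D ∩ S) := hinj.mono Set.inter_subset_right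
  have h₁ : stdGaussian (EuclideanSpace ℝ ι) D ≤
      stdGaussian (EuclideanSpace ℝ ι) (D ∩ S) + stdGaussian (EuclideanSpace ℝ ι) Sᶜ := by
    refine (measure_mono fun y hy => ?_).trans (measure_union_le _ _)
    by_cases hyS : y ∈ S
    · exact Or.inl ⟨hy, hyS⟩
    · exact Or.inr hyS
  have h₂ : stdGaussian (EuclideanSpace ℝ ι) (D ∩ S) ≤
      stdGaussian (EuclideanSpace ℝ ι) (h '' (D ∩ S)) +
        ∫⁻ y, ε y ∂stdGaussian (EuclideanSpace ℝ ι) := by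
    have hm := measurable_image_of_fderivWithin hDS hd hi
    rw [stdGaussian_eq_withDensity, withDensity_apply _ hDS, withDensity_apply _ hm,
      lintegral_image_eq_lintegral_abs_det_fderiv_mul volume hDS hd hi,
      lintegral_withDensity_eq_lintegral_mul _ measurable_stdGaussianPDF hε]
    calc ∫⁻ y in D ∩ S, stdGaussianPDF y
        ≤ ∫⁻ y in D ∩ S, (ENNReal.ofReal |(h' y).det| * stdGaussianPDF (h y) +
            stdGaussianPDF y * ε y) := by
          refine setLIntegral_mono' hDS fun y hy => ?_
          calc stdGaussianPDF y = stdGaussianPDF y * 1 := (mul_one _).symm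
            _ ≤ stdGaussianPDF y * _ := mul_le_mul_right (hle y hy.2) _
            _ = _ := by
              rw [mul_add]
              congr 1
              unfold stdGaussianPDF
              rw [← ENNReal.ofReal_mul (by positivity), ← ENNReal.ofReal_mul (by positivity)]
              congr 1
              rw [show -(‖h y‖ ^ 2 / 2) = -(‖y‖ ^ 2 / 2) + (‖y‖ ^ 2 - ‖h y‖ ^ 2) / 2 by ring,
                Real.exp_add]
              ring
      _ = (∫⁻ y in D ∩ S, ENNReal.ofReal |(h' y).det| * stdGaussianPDF (h y)) +
            ∫⁻ y in D ∩ S, (stdGaussianPDF * ε : EuclideanSpace ℝ ι → ℝ≥0∞) y :=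
          lintegral_add_right _ (measurable_stdGaussianPDF.mul hε)
      _ ≤ _ := add_le_add_right (setLIntegral_le_lintegral _ _) _
  calc _ ≤ _ := h₁
    _ ≤ _ := add_le_add_left h₂ _
    _ = _ := by ring

theorem lintegral_norm_pow_stdGaussian_lt_top (p : ℕ) :
    ∫⁻ y, ENNReal.ofReal (‖y‖ ^ p) ∂stdGaussian (EuclideanSpace ℝ ι) < ∞ := by
  by_cases hp : p = 0
  · simp [hp]
  have h := (IsGaussian.memLp_id (stdGaussian (EuclideanSpace ℝ ι)) p (by simp)).integrable_norm_pow hp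
  simpa [ofReal_norm, Integrable, HasFiniteIntegral, ENNReal.ofReal_pow] using h.2

end Density

/-! ### Comparison under the radial map. -/

section Radial

variable {ι : Type*} [Fintype ι]

/-- For `a ≤ 1`, the bound `(a ^ 2) ^ k ≤ a ^ k` reduces the claim to Bernoulli's inequality and
avoids square roots of `x`. -/
theorem one_sub_le_pow_of_le_sq {a x : ℝ} (ha : 0 ≤ a) (hx : x ≤ a ^ 2) (k : ℕ) :
    1 - (k + 1) * |x - 1| ≤ a ^ k := by
  have h₀ := abs_nonneg (x - 1)
  rcases le_total 1 a with h | h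
  · have : 1 ≤ a ^ k := one_le_pow₀ h
    nlinarith [Nat.cast_nonneg (α := ℝ) k]
  · have h₁ : (a ^ 2) ^ k ≤ a ^ k := by
      rw [← pow_mul]
      exact pow_le_pow_of_le_one ha h (by omega)
    have h₂ := one_add_mul_le_pow (a := a ^ 2 - 1) (by nlinarith) k
    rw [add_sub_cancel] at h₂
    have h₃ : (k : ℝ) * (-|x - 1|) ≤ k * (a ^ 2 - 1) := by
      gcongr
      linarith [neg_abs_le (x - 1)]
    nlinarith

theorem one_sub_add_le_mul {p q a b : ℝ} (ha : 0 ≤ a) (hb : 0 ≤ b) (hp : 0 ≤ p) (hq : 0 ≤ q)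
    (hpa : 1 - a ≤ p) (hqb : 1 - b ≤ q) : 1 - (a + b) ≤ p * q := by
  by_cases h : 1 ≤ a + b
  · nlinarith
  · nlinarith [mul_nonneg ha hb, mul_nonneg (sub_nonneg.2 hpa) hq,
      mul_nonneg (sub_nonneg.2 hqb) (show 0 ≤ 1 - a by linarith)]

/-- The map sending `z` to the point of the sphere of radius `√n` on the ray through `(z, ρ)`,
projected to the first component. -/
noncomputable def radialContraction (n ρ : ℝ) (z : EuclideanSpace ℝ ι) : EuclideanSpace ℝ ι :=
  (√n / √(‖z‖ ^ 2 + ρ ^ 2)) • z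

/-- The inverse of `radialContraction n ρ` on the ball of radius `√n`. -/
noncomputable def radialExpansion (n ρ : ℝ) (y : EuclideanSpace ℝ ι) : EuclideanSpace ℝ ι :=
  (ρ / √(n - ‖y‖ ^ 2)) • y

theorem norm_radialExpansion_sq {n ρ : ℝ} {y : EuclideanSpace ℝ ι} (hy : ‖y‖ ^ 2 < n) :
    ‖radialExpansion n ρ y‖ ^ 2 = ρ ^ 2 / (n - ‖y‖ ^ 2) * ‖y‖ ^ 2 := by
  rw [radialExpansion, norm_smul, mul_pow, Real.norm_eq_abs, sq_abs, div_pow,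
    Real.sq_sqrt (by linarith)]

theorem radialContraction_radialExpansion {n ρ : ℝ} (hρ : 0 < ρ) {y : EuclideanSpace ℝ ι}
    (hy : ‖y‖ ^ 2 < n) : radialContraction n ρ (radialExpansion n ρ y) = y := by
  have hs : 0 < n - ‖y‖ ^ 2 := by linarith
  have hn : 0 < n := by nlinarith [sq_nonneg ‖y‖]
  rw [radialContraction, norm_radialExpansion_sq hy, radialExpansion, smul_smul]
  have : ρ ^ 2 / (n - ‖y‖ ^ 2) * ‖y‖ ^ 2 + ρ ^ 2 = ρ ^ 2 * n / (n - ‖y‖ ^ 2) := by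
    field_simp
    ring
  rw [this, Real.sqrt_div (by positivity), Real.sqrt_mul (by positivity), Real.sqrt_sq hρ.le]
  have h₁ : 0 < √n := Real.sqrt_pos.2 hn
  have h₂ : 0 < √(n - ‖y‖ ^ 2) := Real.sqrt_pos.2 hs
  rw [show √n / (ρ * √n / √(n - ‖y‖ ^ 2)) * (ρ / √(n - ‖y‖ ^ 2)) = 1 by field_simp, one_smul]

theorem hasFDerivAt_radialExpansion {n ρ : ℝ} {y : EuclideanSpace ℝ ι} (hy : ‖y‖ ^ 2 < n) :
    HasFDerivAt (radialExpansion n ρ)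
      ((ρ / √(n - ‖y‖ ^ 2)) • (ContinuousLinearMap.id ℝ (EuclideanSpace ℝ ι) +
        ((n - ‖y‖ ^ 2)⁻¹ • innerSL ℝ y).smulRight y)) y := by
  have hs : 0 < n - ‖y‖ ^ 2 := by linarith
  have h₁ : HasFDerivAt (fun y : EuclideanSpace ℝ ι => n - ‖y‖ ^ 2) (-(2 • innerSL ℝ y)) y :=
    (hasStrictFDerivAt_norm_sq y).hasFDerivAt.const_sub n
  have h₂ := ((Real.hasDerivAt_sqrt hs.ne').inv (Real.sqrt_pos.2 hs).ne').const_mul ρ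
  have h₃ := (h₂.comp_hasFDerivAt y h₁).smul (hasFDerivAt_id y)
  refine (h₃.congr_fderiv ?_).congr_of_eventuallyEq (Filter.Eventually.of_forall fun x => ?_)
  · ext1 v
    have h₄ : 0 < √(n - ‖y‖ ^ 2) := Real.sqrt_pos.2 hs
    have h₅ : √(n - ‖y‖ ^ 2) ^ 2 = n - ‖y‖ ^ 2 := Real.sq_sqrt hs.le
    simp only [Function.comp_apply, id_eq, add_apply,
      smul_apply, ContinuousLinearMap.smulRight_apply,
      neg_apply, innerSL_apply_apply, ContinuousLinearMap.id_apply,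
      Pi.inv_apply, smul_add, smul_smul, smul_eq_mul, nsmul_eq_mul, h₅]
    congr 2
    field_simp
    simp
  · simp [radialExpansion, div_eq_mul_inv]

/-- The derivative is a scalar times a rank-one perturbation of the identity, whose determinant `1 +
‖y‖² / (n - ‖y‖²)` is at least 1 and can be dropped. -/
theorem le_abs_det_fderiv_radialExpansion {n ρ : ℝ} (hρ : 0 ≤ ρ) {y : EuclideanSpace ℝ ι}
    (hy : ‖y‖ ^ 2 < n) :
    (ρ / √(n - ‖y‖ ^ 2)) ^ Fintype.card ι ≤
      |((ρ / √(n - ‖y‖ ^ 2)) • (ContinuousLinearMap.id ℝ (EuclideanSpace ℝ ι) +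
        ((n - ‖y‖ ^ 2)⁻¹ • innerSL ℝ y).smulRight y)).det| := by
  have hs : 0 < n - ‖y‖ ^ 2 := by linarith
  have h₁ : ContinuousLinearMap.det ((ρ / √(n - ‖y‖ ^ 2)) •
      (ContinuousLinearMap.id ℝ (EuclideanSpace ℝ ι) +
        ((n - ‖y‖ ^ 2)⁻¹ • innerSL ℝ y).smulRight y)) =
      LinearMap.det ((ρ / √(n - ‖y‖ ^ 2)) •
        LinearMap.transvection (((n - ‖y‖ ^ 2)⁻¹ • innerSL ℝ y : EuclideanSpace ℝ ι →L[ℝ] ℝ) :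
          EuclideanSpace ℝ ι →ₗ[ℝ] ℝ) y) := by
    unfold ContinuousLinearMap.det
    congr 1
  rw [h₁, LinearMap.det_smul, LinearMap.transvection.det, finrank_euclideanSpace]
  have h₂ : 0 ≤ (n - ‖y‖ ^ 2)⁻¹ * ‖y‖ ^ 2 := by positivity
  have h₃ : 0 ≤ (ρ / √(n - ‖y‖ ^ 2)) ^ Fintype.card ι := by positivity
  simp only [ContinuousLinearMap.coe_coe, smul_apply, innerSL_apply_apply,
    real_inner_self_eq_norm_sq, smul_eq_mul]
  rw [abs_of_nonneg (by positivity)]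
  nlinarith

theorem stdGaussian_le_preimage_radialContraction_add (ι : Type*) [Fintype ι] :
    ∃ C : ℝ≥0∞, C ≠ ∞ ∧ ∀ n : ℝ, 0 < n → ∀ ρ : ℝ, 0 ≤ ρ →
      ∀ D : Set (EuclideanSpace ℝ ι), MeasurableSet D →
        stdGaussian (EuclideanSpace ℝ ι) D ≤
          stdGaussian (EuclideanSpace ℝ ι) (radialContraction n ρ ⁻¹' D) +
            C * (ENNReal.ofReal |ρ ^ 2 / n - 1| + ENNReal.ofReal (1 / n)) := by
  set γ := stdGaussian (EuclideanSpace ℝ ι)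
  set k := Fintype.card ι
  set M₂ := ∫⁻ y, ENNReal.ofReal (‖y‖ ^ 2) ∂γ
  set M₄ := ∫⁻ y, ENNReal.ofReal (‖y‖ ^ 4) ∂γ
  have hM₂ : M₂ < ∞ := lintegral_norm_pow_stdGaussian_lt_top 2
  have hM₄ : M₄ < ∞ := lintegral_norm_pow_stdGaussian_lt_top 4
  -- `(k + 1) + M₂` goes with `|ρ²/n - 1|`, from the Jacobian and the exponent. `M₄ + 2 * M₂` goes
  -- with `1/n`, from the exponent and the complement of `S`. The summand 1 also covers `ρ = 0`.
  refine ⟨(k + 1) + M₂ + (M₄ + 2 * M₂), by finiteness, fun n hn ρ hρ D hD => ?_⟩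
  set x := ρ ^ 2 / n with hx
  -- For `ρ = 0` the expansion collapses to 0, but then `|ρ²/n - 1| = 1` and the bound is trivial.
  rcases hρ.eq_or_lt with rfl | hρ
  · have : x = 0 := by simp [x]
    calc γ D ≤ 1 := prob_le_one
      _ = 1 * (1 + 0) := by simp
      _ ≤ ((k + 1) + M₂ + (M₄ + 2 * M₂)) *
          (ENNReal.ofReal |x - 1| + ENNReal.ofReal (1 / n)) := by
        gcongr
        · rw [add_comm (k : ℝ≥0∞), add_assoc, add_assoc]; exact le_self_add
        · simp [this]
        · exact zero_le
      _ ≤ _ := le_add_self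
  -- The threshold `n / 2` keeps `2 * (n - ‖y‖ ^ 2) ≥ n`, and by Markov's inequality the complement
  -- has mass at most `2 * M₂ / n`.
  set S : Set (EuclideanSpace ℝ ι) := {y | ‖y‖ ^ 2 < n / 2}
  have hS : MeasurableSet S := measurableSet_lt (by fun_prop) measurable_const
  have hSn : ∀ y ∈ S, ‖y‖ ^ 2 < n := fun y hy => lt_trans hy (by linarith)
  set ε : EuclideanSpace ℝ ι → ℝ≥0∞ := fun y =>
    ((k + 1) + ENNReal.ofReal (‖y‖ ^ 2)) * ENNReal.ofReal |x - 1| +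
      ENNReal.ofReal (‖y‖ ^ 4) * ENNReal.ofReal (1 / n)
  have hε : Measurable ε := by fun_prop
  have main := stdGaussian_le_image_add hS (h := radialExpansion n ρ)
    (fun y hy => hasFDerivAt_radialExpansion (hSn y hy))
    (fun y hy z hz hyz => by
      rw [← radialContraction_radialExpansion hρ (hSn y hy), hyz,
        radialContraction_radialExpansion hρ (hSn z hz)]) hε ?_ hD
  · refine main.trans (add_le_add (measure_mono ?_) ?_)
    · rintro _ ⟨y, hy, rfl⟩
      simpa [radialContraction_radialExpansion hρ (hSn y hy.2)] using hy.1
    · have h₁ : γ Sᶜ ≤ 2 * M₂ * ENNReal.ofReal (1 / n) := by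
        have h := mul_meas_ge_le_lintegral (μ := γ)
          (f := fun y => ENNReal.ofReal (‖y‖ ^ 2)) (by fun_prop) (ENNReal.ofReal (n / 2))
        have hsub : Sᶜ ⊆ {y : EuclideanSpace ℝ ι |
            ENNReal.ofReal (n / 2) ≤ ENNReal.ofReal (‖y‖ ^ 2)} :=
          fun y hy => ENNReal.ofReal_le_ofReal (not_lt.1 hy)
        have h2 : ENNReal.ofReal (1 / n) * 2 * ENNReal.ofReal (n / 2) = 1 := by
          rw [← ENNReal.ofReal_ofNat 2, ← ENNReal.ofReal_mul (by positivity),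
            ← ENNReal.ofReal_mul (by positivity)]
          rw [← ENNReal.ofReal_one]
          congr 1
          field_simp
        calc γ Sᶜ ≤ γ {y | ENNReal.ofReal (n / 2) ≤ ENNReal.ofReal (‖y‖ ^ 2)} :=
              measure_mono hsub
          _ = ENNReal.ofReal (1 / n) * 2 * (ENNReal.ofReal (n / 2) *
                γ {y | ENNReal.ofReal (n / 2) ≤ ENNReal.ofReal (‖y‖ ^ 2)}) := by
              rw [← mul_assoc, h2, one_mul]
          _ ≤ ENNReal.ofReal (1 / n) * 2 * M₂ := mul_le_mul_right h _
          _ = _ := by ring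
      have h₂ : ∫⁻ y, ε y ∂γ = ((k + 1) + M₂) * ENNReal.ofReal |x - 1| +
          M₄ * ENNReal.ofReal (1 / n) := by
        simp only [ε]
        rw [lintegral_add_left (by fun_prop), lintegral_mul_const _ (by fun_prop),
          lintegral_mul_const _ (by fun_prop), lintegral_add_left (by fun_prop)]
        simp [M₂, M₄]
      calc γ Sᶜ + ∫⁻ y, ε y ∂γ
          ≤ 2 * M₂ * ENNReal.ofReal (1 / n) + (((k + 1) + M₂) * ENNReal.ofReal |x - 1| +
            M₄ * ENNReal.ofReal (1 / n)) := add_le_add h₁ h₂.le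
        _ = ((k + 1) + M₂) * ENNReal.ofReal |x - 1| +
            (M₄ + 2 * M₂) * ENNReal.ofReal (1 / n) := by ring
        _ ≤ _ := by
          rw [mul_add]
          exact add_le_add (mul_le_mul_left le_self_add _) (mul_le_mul_left le_add_self _)
  · intro y hy
    have hyn := hSn y hy
    have hs : 0 < n - ‖y‖ ^ 2 := by linarith
    have hs2 : n / 2 ≤ n - ‖y‖ ^ 2 := by
      have : ‖y‖ ^ 2 < n / 2 := hy
      linarith
    have hy0 := sq_nonneg ‖y‖
    have e₁ : ε y = ENNReal.ofReal ((‖y‖ ^ 2 * |x - 1| + ‖y‖ ^ 4 * (1 / n)) +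
        (k + 1) * |x - 1|) := by
      rw [ENNReal.ofReal_add (by positivity) (by positivity),
        ENNReal.ofReal_add (by positivity) (by positivity), ENNReal.ofReal_mul (by positivity),
        ENNReal.ofReal_mul (by positivity), ENNReal.ofReal_mul (by positivity),
        ENNReal.ofReal_add (by positivity) (by positivity)]
      simp only [ε, ENNReal.ofReal_natCast, ENNReal.ofReal_one]
      ring
    rw [e₁, ← ENNReal.ofReal_add (by positivity) (by positivity), ← ENNReal.ofReal_one]
    refine ENNReal.ofReal_le_ofReal ?_
    rw [← sub_le_iff_le_add]
    -- The two losses are bounded separately: the exponential through `1 + t ≤ exp t`, the Jacobian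
    -- through `ρ² / (n - ‖y‖²) ≥ ρ² / n`.
    refine one_sub_add_le_mul (by positivity) (by positivity) (by positivity) (by positivity) ?_
      ((one_sub_le_pow_of_le_sq (by positivity) ?_ k).trans
        (le_abs_det_fderiv_radialExpansion hρ.le hyn))
    · refine le_trans ?_ (Real.add_one_le_exp _)
      rw [norm_radialExpansion_sq hyn, sub_eq_neg_add, add_le_add_iff_right]
      have h₁ : (‖y‖ ^ 2 - ρ ^ 2 / (n - ‖y‖ ^ 2) * ‖y‖ ^ 2) / 2 =
          ‖y‖ ^ 2 * (-(ρ ^ 2 - n + ‖y‖ ^ 2) / (2 * (n - ‖y‖ ^ 2))) := by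
        field_simp
        ring
      have h₂ : ‖y‖ ^ 2 * |x - 1| + ‖y‖ ^ 4 * (1 / n) =
          ‖y‖ ^ 2 * ((|ρ ^ 2 - n| + ‖y‖ ^ 2) / n) := by
        have : x - 1 = (ρ ^ 2 - n) / n := by rw [hx]; field_simp
        rw [this, abs_div, abs_of_pos hn]
        ring
      rw [h₁, h₂, ← mul_neg]
      refine mul_le_mul_of_nonneg_left ?_ hy0
      rw [neg_div, neg_le_neg_iff]
      calc (ρ ^ 2 - n + ‖y‖ ^ 2) / (2 * (n - ‖y‖ ^ 2))
          ≤ (|ρ ^ 2 - n| + ‖y‖ ^ 2) / (2 * (n - ‖y‖ ^ 2)) := by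
            gcongr
            exact le_abs_self _
        _ ≤ _ := by
            gcongr
            linarith
    · rw [hx, div_pow, Real.sq_sqrt hs.le]
      gcongr
      linarith

end Radial

/-! ### Comparison under a matrix with nearly orthonormal rows. -/

section Matrix

variable {ι : Type*} [Fintype ι]

theorem abs_dotProduct_mulVec_le (E : Matrix ι ι ℝ) (u v : ι → ℝ) :
    |u ⬝ᵥ E *ᵥ v| ≤ (∑ i, ∑ j, |E i j|) * (√(u ⬝ᵥ u) * √(v ⬝ᵥ v)) := by
  have h : ∀ (w : ι → ℝ) (i : ι), |w i| ≤ √(w ⬝ᵥ w) := by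
    intro w i
    refine Real.abs_le_sqrt ?_
    rw [sq]
    exact Finset.single_le_sum (f := fun i => w i * w i) (fun i _ => mul_self_nonneg _)
      (Finset.mem_univ i)
  simp only [dotProduct, Matrix.mulVec, Finset.mul_sum, Finset.sum_mul]
  refine (Finset.abs_sum_le_sum_abs _ _).trans (Finset.sum_le_sum fun i _ => ?_)
  refine (Finset.abs_sum_le_sum_abs _ _).trans (Finset.sum_le_sum fun j _ => ?_)
  rw [abs_mul, abs_mul, mul_left_comm]
  exact mul_le_mul_of_nonneg_left
    (mul_le_mul (h u i) (h v j) (abs_nonneg _) (Real.sqrt_nonneg _)) (abs_nonneg _)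

variable [DecidableEq ι]

/-- The determinant is the product of the diagonal entries, each bounded by the norm of its row. -/
theorem Matrix.abs_det_le_one_of_lowerTriangular [LinearOrder ι] {L : Matrix ι ι ℝ}
    (hL : ∀ i j, i < j → L i j = 0) (hrow : ∀ i, ∑ j, L i j ^ 2 = 1) : |L.det| ≤ 1 := by
  rw [Matrix.det_of_isLowerTriangular L fun i j hij => hL i j hij, Finset.abs_prod]
  refine Finset.prod_le_one (fun i _ => abs_nonneg _) fun i _ => ?_
  rw [← sq_le_one_iff_abs_le_one, ← hrow i]
  exact Finset.single_le_sum (f := fun j => L i j ^ 2) (fun j _ => sq_nonneg _)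
    (Finset.mem_univ i)

/-- On a kernel vector `u` of `Lᵀ` the form of `L * Lᵀ - 1` equals `-‖u‖²`, too large for a
perturbation of size `1 / 2`. -/
theorem Matrix.det_ne_zero_of_gram_near_one {L : Matrix ι ι ℝ}
    (he : ∑ i, ∑ j, |(L * Lᵀ - 1) i j| ≤ 1 / 2) : L.det ≠ 0 := by
  intro h0
  rw [← Matrix.det_transpose, ← Matrix.exists_mulVec_eq_zero_iff] at h0
  obtain ⟨u, hu, hLu⟩ := h0
  have h := abs_dotProduct_mulVec_le (L * Lᵀ - 1) u u
  have h0 : 0 ≤ u ⬝ᵥ u := Finset.sum_nonneg fun i _ => mul_self_nonneg _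
  have h0' : u ⬝ᵥ u ≠ 0 := fun h => hu (dotProduct_self_eq_zero.1 h)
  rw [Matrix.sub_mulVec, ← Matrix.mulVec_mulVec, hLu, Matrix.mulVec_zero, Matrix.one_mulVec,
    zero_sub, dotProduct_neg, abs_neg, abs_of_nonneg h0, Real.mul_self_sqrt h0] at h
  have : 0 < u ⬝ᵥ u := lt_of_le_of_ne h0 h0'.symm
  nlinarith

/-- Put `u = (L Lᵀ)⁻¹ y` and `E = L Lᵀ - 1`. Then `‖L⁻¹ y‖² = u ⬝ᵥ y` and `y - u = E u`, so the
difference is `-(y ⬝ᵥ E u) ≤ e ‖y‖ ‖u‖`. Pairing `y - u = E u` with `u` gives `‖u‖ ≤ 2 ‖y‖` when `e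
≤ 1/2`. -/
theorem dotProduct_inv_mulVec_self_le {L : Matrix ι ι ℝ}
    (he : ∑ i, ∑ j, |(L * Lᵀ - 1) i j| ≤ 1 / 2) (y : ι → ℝ) :
    (L⁻¹ *ᵥ y) ⬝ᵥ (L⁻¹ *ᵥ y) - y ⬝ᵥ y ≤
      2 * (∑ i, ∑ j, |(L * Lᵀ - 1) i j|) * (y ⬝ᵥ y) := by
  have hdet : IsUnit L.det := (Matrix.det_ne_zero_of_gram_near_one he).isUnit
  set E := L * Lᵀ - 1 with hE
  set e := ∑ i, ∑ j, |E i j|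
  set z := L⁻¹ *ᵥ y
  set u := L⁻¹ᵀ *ᵥ z with hu
  have hyz : L *ᵥ z = y := by
    rw [Matrix.mulVec_mulVec, Matrix.mul_nonsing_inv _ hdet, Matrix.one_mulVec]
  have hz : z = Lᵀ *ᵥ u := by
    rw [hu, Matrix.mulVec_mulVec, ← Matrix.transpose_mul, Matrix.nonsing_inv_mul _ hdet,
      Matrix.transpose_one, Matrix.one_mulVec]
  have hEu : E *ᵥ u = y - u := by
    rw [hE, Matrix.sub_mulVec, ← Matrix.mulVec_mulVec, ← hz, hyz, Matrix.one_mulVec]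
  have hzz : z ⬝ᵥ z = u ⬝ᵥ y := by
    calc z ⬝ᵥ z = (Lᵀ *ᵥ u) ⬝ᵥ z := congrArg (· ⬝ᵥ z) hz
      _ = u ⬝ᵥ y := by rw [Matrix.mulVec_transpose, ← Matrix.dotProduct_mulVec, hyz]
  have nonneg : ∀ w : ι → ℝ, 0 ≤ w ⬝ᵥ w :=
    fun w => Finset.sum_nonneg fun i _ => mul_self_nonneg _
  have h₁ := abs_dotProduct_mulVec_le E u u
  have h₂ := abs_dotProduct_mulVec_le E y u
  have he0 : 0 ≤ e := Finset.sum_nonneg fun i _ => Finset.sum_nonneg fun j _ => abs_nonneg _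
  have hcs : u ⬝ᵥ y ≤ √(u ⬝ᵥ u) * √(y ⬝ᵥ y) := by
    have h := Finset.sum_mul_sq_le_sq_mul_sq Finset.univ u y
    rw [← Real.sqrt_mul (nonneg u)]
    refine Real.le_sqrt_of_sq_le ?_
    simpa [dotProduct, sq] using h
  rw [hEu, dotProduct_sub] at h₁ h₂
  have hsu := Real.mul_self_sqrt (nonneg u)
  have hsy := Real.mul_self_sqrt (nonneg y)
  set a := √(u ⬝ᵥ u)
  set b := √(y ⬝ᵥ y)
  have ha : 0 ≤ a := Real.sqrt_nonneg _
  have hb : 0 ≤ b := Real.sqrt_nonneg _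
  have hab : a ≤ 2 * b := by
    rw [← hsu] at h₁
    have h₄ := (abs_le.1 h₁).1
    by_contra! hlt
    nlinarith [mul_nonneg ha ha, mul_le_mul_of_nonneg_right he (mul_nonneg ha ha)]
  rw [hzz, dotProduct_comm u y, ← hsy]
  have h₅ := (abs_le.1 h₂).1
  rw [← hsy] at h₅
  nlinarith [mul_le_mul_of_nonneg_left hab (mul_nonneg he0 hb)]

end Matrix

/-- Since `|L.det| ≤ 1`, the Jacobian of `L⁻¹` is at least 1, and only the change in the exponent
costs anything: at most `e * ‖y‖ ^ 2`, with mean `e * M₂`. The summand 2 makes the bound trivial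
once `e > 1 / 2`. -/
theorem stdGaussian_le_preimage_matrix_add (ι : Type*) [Fintype ι] [DecidableEq ι] :
    ∃ C : ℝ≥0∞, C ≠ ∞ ∧ ∀ L : Matrix ι ι ℝ, |L.det| ≤ 1 →
      ∀ D : Set (EuclideanSpace ℝ ι), MeasurableSet D →
        stdGaussian (EuclideanSpace ℝ ι) D ≤
          stdGaussian (EuclideanSpace ℝ ι) (Matrix.toEuclideanCLM (𝕜 := ℝ) L ⁻¹' D) +
            C * ENNReal.ofReal (∑ i, ∑ j, |(L * Lᵀ - 1) i j|) := by
  set γ := stdGaussian (EuclideanSpace ℝ ι)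
  set M₂ := ∫⁻ y, ENNReal.ofReal (‖y‖ ^ 2) ∂γ
  have hM₂ : M₂ < ∞ := lintegral_norm_pow_stdGaussian_lt_top 2
  refine ⟨2 + M₂, by finiteness, fun L hL D hD => ?_⟩
  set e := ∑ i, ∑ j, |(L * Lᵀ - 1) i j|
  have he0 : 0 ≤ e := Finset.sum_nonneg fun i _ => Finset.sum_nonneg fun j _ => abs_nonneg _
  rcases le_or_gt e (1 / 2) with he | he
  · have hdet := Matrix.det_ne_zero_of_gram_near_one he
    have hLh : ∀ y, Matrix.toEuclideanCLM (𝕜 := ℝ) L (Matrix.toEuclideanCLM (𝕜 := ℝ) L⁻¹ y) = y := by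
      intro y
      rw [← mul_apply_eq_comp, ← map_mul, Matrix.mul_nonsing_inv _ hdet.isUnit, map_one,
        one_apply_eq_self]
    have main := stdGaussian_le_image_add MeasurableSet.univ
      (h := Matrix.toEuclideanCLM (𝕜 := ℝ) L⁻¹) (h' := fun _ => Matrix.toEuclideanCLM (𝕜 := ℝ) L⁻¹)
      (fun y _ => ContinuousLinearMap.hasFDerivAt _)
      (fun y _ z _ hyz => by rw [← hLh y, hyz, hLh z])
      (ε := fun y => ENNReal.ofReal (‖y‖ ^ 2) * ENNReal.ofReal e) (by fun_prop) ?_ hD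
    · refine main.trans (add_le_add (measure_mono ?_) ?_)
      · rintro _ ⟨y, hy, rfl⟩
        simpa [hLh y] using hy.1
      · rw [lintegral_mul_const _ (by fun_prop), Set.compl_univ, measure_empty, zero_add]
        exact mul_le_mul_left le_add_self _
    · intro y _
      rw [← ENNReal.ofReal_mul (by positivity), ← ENNReal.ofReal_add (by positivity) (by positivity),
        ← ENNReal.ofReal_one]
      refine ENNReal.ofReal_le_ofReal ?_
      have h₁ : 1 ≤ |(Matrix.toEuclideanCLM (𝕜 := ℝ) L⁻¹).det| := by
        have : (Matrix.toEuclideanCLM (𝕜 := ℝ) L⁻¹).det = L⁻¹.det := by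
          rw [ContinuousLinearMap.det, Matrix.coe_toEuclideanCLM_eq_toEuclideanLin]
          simp
        rw [this, Matrix.det_nonsing_inv, Ring.inverse_eq_inv', abs_inv]
        exact (one_le_inv₀ (abs_pos.2 hdet)).2 hL
      have h₂ : ‖Matrix.toEuclideanCLM (𝕜 := ℝ) L⁻¹ y‖ ^ 2 - ‖y‖ ^ 2 ≤ 2 * e * ‖y‖ ^ 2 := by
        have h := dotProduct_inv_mulVec_self_le he y.ofLp
        have hn : ∀ x : EuclideanSpace ℝ ι, ‖x‖ ^ 2 = x.ofLp ⬝ᵥ x.ofLp := by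
          intro x
          rw [EuclideanSpace.real_norm_sq_eq]
          exact Finset.sum_congr rfl fun i _ => sq _
        rw [hn, hn, Matrix.ofLp_toEuclideanCLM]
        exact h
      have h₃ := Real.add_one_le_exp
        ((‖y‖ ^ 2 - ‖Matrix.toEuclideanCLM (𝕜 := ℝ) L⁻¹ y‖ ^ 2) / 2)
      have h₄ := Real.exp_pos ((‖y‖ ^ 2 - ‖Matrix.toEuclideanCLM (𝕜 := ℝ) L⁻¹ y‖ ^ 2) / 2)
      nlinarith [mul_le_mul_of_nonneg_left h₁ h₄.le]
  · calc γ D ≤ 1 := prob_le_one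
      _ ≤ 2 * ENNReal.ofReal e := by
        rw [← ENNReal.ofReal_ofNat 2, ← ENNReal.ofReal_mul (by positivity), ← ENNReal.ofReal_one]
        exact ENNReal.ofReal_le_ofReal (by linarith)
      _ ≤ (2 + M₂) * ENNReal.ofReal e := mul_le_mul_left le_self_add _
      _ ≤ _ := le_add_self

/-! ### Concentration of the squared Gaussian norm. -/

/-- Turns second-moment bounds into first-moment bounds; with `t = √n`, a second moment of order
`1/n` gives order `1/√n`. -/
theorem abs_le_mul_sq_add {t : ℝ} (ht : 0 < t) (a : ℝ) : |a| ≤ t / 2 * a ^ 2 + 1 / (2 * t) := by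
  have h : t / 2 * a ^ 2 + 1 / (2 * t) - |a| = (t * |a| - 1) ^ 2 / (2 * t) := by
    rw [← sq_abs a]
    field_simp
    ring
  have : 0 ≤ (t * |a| - 1) ^ 2 / (2 * t) := by positivity
  linarith

theorem lintegral_norm_sq_sub_card_sq {ι : Type*} [Fintype ι] :
    ∫⁻ w, ENNReal.ofReal ((‖w‖ ^ 2 - Fintype.card ι) ^ 2) ∂stdGaussian (EuclideanSpace ℝ ι) =
      ENNReal.ofReal (Fintype.card ι * Var[fun x => x ^ 2; gaussianReal 0 1]) := by
  have hmem : MemLp (fun x : ℝ => x ^ 2) 2 (gaussianReal 0 1) := by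
    have h := (memLp_id_gaussianReal (μ := 0) (v := 1) 4).norm_rpow_div 2
    have h2 : (4 / 2 : ℝ≥0∞) = 2 := by
      rw [show (4 : ℝ≥0∞) = 2 * 2 by norm_num, ENNReal.mul_div_cancel_right] <;> simp
    simpa [h2] using h
  have hmem' : ∀ i : ι, MemLp (fun x : ι → ℝ => x i ^ 2) 2
      (Measure.pi fun _ : ι => gaussianReal 0 1) := fun i =>
    hmem.comp_measurePreserving (measurePreserving_eval (fun _ : ι => gaussianReal 0 1) i)
  have hone : ∫ x, x ^ 2 ∂gaussianReal 0 1 = 1 := by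
    have h := variance_id_gaussianReal (μ := 0) (v := 1)
    rw [variance_of_integral_eq_zero aemeasurable_id (by simp)] at h
    simpa using h
  have hmean : ∫ x : ι → ℝ, ∑ i, x i ^ 2 ∂(Measure.pi fun _ : ι => gaussianReal 0 1) =
      Fintype.card ι := by
    rw [integral_finsetSum _ fun i _ => (hmem' i).integrable (by norm_num)]
    have : ∀ i : ι, ∫ x : ι → ℝ, x i ^ 2 ∂(Measure.pi fun _ : ι => gaussianReal 0 1) = 1 := by
      intro i
      rw [← hone]
      exact integral_comp_eval (μ := fun _ : ι => gaussianReal 0 1) (i := i)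
        (f := fun x : ℝ => x ^ 2) (by fun_prop)
    simp [this]
  have hvar : Var[fun x : ι → ℝ => ∑ i, x i ^ 2; Measure.pi fun _ : ι => gaussianReal 0 1] =
      Fintype.card ι * Var[fun x => x ^ 2; gaussianReal 0 1] := by
    have := variance_sum_pi (μ := fun _ : ι => gaussianReal 0 1) (X := fun _ x => x ^ 2)
      fun _ => hmem
    rw [show (fun x : ι → ℝ => ∑ i, x i ^ 2) = ∑ i, fun x : ι → ℝ => x i ^ 2 by ext; simp]
    simpa using this
  rw [← map_pi_eq_stdGaussian, lintegral_map (by fun_prop) (by fun_prop), ← hvar,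
    (memLp_finsetSum Finset.univ fun i _ => hmem' i).ofReal_variance_eq, evariance, hmean]
  refine lintegral_congr fun x => ?_
  rw [EuclideanSpace.real_norm_sq_eq, Real.enorm_eq_ofReal_abs, ← ENNReal.ofReal_pow (abs_nonneg _),
    sq_abs]

/-- `‖w‖²` has mean `m` and variance proportional to `m ≤ n`; recentring from `m` to `n = k + m`
costs `k / n ≤ k / √n`. -/
theorem lintegral_abs_norm_sq_div_sub_one_le (k : ℕ) :
    ∃ C : ℝ≥0∞, C ≠ ∞ ∧ ∀ m : ℕ, 1 ≤ k + m →
      ∫⁻ w, ENNReal.ofReal |‖w‖ ^ 2 / (k + m : ℕ) - 1| ∂stdGaussian (EuclideanSpace ℝ (Fin m)) ≤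
        C * ENNReal.ofReal (1 / √(k + m : ℕ)) := by
  set V := Var[fun x : ℝ => x ^ 2; gaussianReal 0 1]
  have hV : 0 ≤ V := variance_nonneg _ _
  refine ⟨ENNReal.ofReal (V + 1 + k), by finiteness, fun m hn => ?_⟩
  set n : ℝ := ((k + m : ℕ) : ℝ) with hn_def
  have hn1 : 1 ≤ n := by rw [hn_def]; exact_mod_cast hn
  have hs1 : 1 ≤ √n := Real.one_le_sqrt.2 hn1
  have hs2 : √n * √n = n := Real.mul_self_sqrt (by linarith)
  have hkm : n = k + m := by rw [hn_def]; push_cast; ring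
  have hm : (m : ℝ) ≤ n := by rw [hkm]; linarith [Nat.cast_nonneg (α := ℝ) k]
  calc ∫⁻ w, ENNReal.ofReal |‖w‖ ^ 2 / n - 1| ∂stdGaussian (EuclideanSpace ℝ (Fin m))
      ≤ ∫⁻ w, (ENNReal.ofReal (√n / (2 * n ^ 2)) * ENNReal.ofReal ((‖w‖ ^ 2 - m) ^ 2) +
          ENNReal.ofReal ((1 / 2 + k) / √n)) ∂stdGaussian (EuclideanSpace ℝ (Fin m)) := by
        refine lintegral_mono fun w => ?_
        rw [← ENNReal.ofReal_mul (by positivity), ← ENNReal.ofReal_add (by positivity)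
          (by positivity)]
        refine ENNReal.ofReal_le_ofReal ?_
        have h₁ : ‖w‖ ^ 2 / n - 1 = (‖w‖ ^ 2 - m) / n + -(k / n) := by
          field_simp
          rw [hkm]; ring
        have h₂ : (k : ℝ) / n ≤ k / √n := by
          gcongr
          nlinarith
        calc |‖w‖ ^ 2 / n - 1| ≤ |(‖w‖ ^ 2 - m) / n| + k / n := by
              rw [h₁]
              refine (abs_add_le _ _).trans ?_
              rw [abs_neg, abs_of_nonneg (a := (k : ℝ) / n) (by positivity)]
          _ ≤ (√n / 2 * ((‖w‖ ^ 2 - m) / n) ^ 2 + 1 / (2 * √n)) + k / √n :=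
              add_le_add (abs_le_mul_sq_add (by positivity) _) h₂
          _ = _ := by
              field_simp
              ring
    _ = ENNReal.ofReal (√n / (2 * n ^ 2) * (m * V) + (1 / 2 + k) / √n) := by
        rw [lintegral_add_right _ measurable_const, lintegral_const_mul _ (by fun_prop)]
        have := lintegral_norm_sq_sub_card_sq (ι := Fin m)
        rw [Fintype.card_fin] at this
        rw [this, ENNReal.ofReal_add (by positivity) (by positivity),
          ENNReal.ofReal_mul (p := √n / (2 * n ^ 2)) (by positivity), lintegral_const,
          measure_univ, mul_one]
    _ ≤ ENNReal.ofReal (V + 1 + k) * ENNReal.ofReal (1 / √n) := by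
        rw [← ENNReal.ofReal_mul (by positivity)]
        refine ENNReal.ofReal_le_ofReal ?_
        calc √n / (2 * n ^ 2) * (m * V) + (1 / 2 + k) / √n
            ≤ √n / (2 * n ^ 2) * (n * V) + (1 / 2 + k) / √n := by gcongr
          _ = (V / 2 + 1 / 2 + k) / √n := by
            have : √n / (2 * n ^ 2) * n = 1 / (2 * √n) := by
              rw [div_mul_eq_mul_div, div_eq_div_iff (by positivity) (by positivity)]
              linear_combination 2 * n * hs2
            rw [← mul_assoc, mul_right_comm, mul_right_comm, this]
            field_simp
            ring
          _ ≤ (V + 1 + k) / √n := by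
            gcongr <;> linarith
          _ = _ := by ring

/-! ### Gaussian vectors and the uniform law on the sphere. -/

theorem stdGaussian_prod_map_orthonormalBasis {ι κ E : Type*} [Fintype ι] [Fintype κ]
    [NormedAddCommGroup E] [InnerProductSpace ℝ E] [FiniteDimensional ℝ E] [MeasurableSpace E]
    [BorelSpace E] (b : OrthonormalBasis (ι ⊕ κ) ℝ E) :
    ((stdGaussian (EuclideanSpace ℝ ι)).prod (stdGaussian (EuclideanSpace ℝ κ))).map
      (fun p => ∑ i, p.1 i • b (Sum.inl i) + ∑ j, p.2 j • b (Sum.inr j)) = stdGaussian E := by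
  have hmp := measurePreserving_sumPiEquivProdPi_symm (X := fun _ : ι ⊕ κ => ℝ)
    fun _ => gaussianReal 0 1
  rw [stdGaussian_eq_map_pi_orthonormalBasis b, ← hmp.map_eq, ← map_pi_eq_stdGaussian,
    ← map_pi_eq_stdGaussian, Measure.map_prod_map _ _ (by fun_prop) (by fun_prop),
    Measure.map_map (by fun_prop) (by fun_prop), Measure.map_map (by fun_prop) hmp.measurable]
  congr 1
  ext p
  simp [Fintype.sum_sum_type]
  rfl

/-- In polar coordinates the Gaussian density depends on the radius alone, so the direction has law
`K` times the surface measure; total mass 1 determines `K`. -/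
theorem sphereUniform_eq_map_stdGaussian {n : ℕ} (hn : 1 ≤ n) :
    sphereUniform n = (stdGaussian (EuclideanSpace ℝ (Fin n))).map fun z => ‖z‖⁻¹ • z := by
  have : Nonempty (Fin n) := ⟨⟨0, hn⟩⟩
  set E := EuclideanSpace ℝ (Fin n)
  set σ := (volume : Measure E).toSphere
  set g : ℝ → ℝ≥0∞ := fun r =>
    ENNReal.ofReal ((√(2 * Real.pi))⁻¹ ^ Fintype.card (Fin n) * Real.exp (-(r ^ 2 / 2)))
  have hg : Measurable g := by fun_prop
  set K := ∫⁻ r : Set.Ioi (0 : ℝ), g r ∂Measure.volumeIoiPow (Module.finrank ℝ E - 1)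
  have hmeas : Measurable fun z : E => ‖z‖⁻¹ • z := by fun_prop
  have key : ∀ A : Set E, MeasurableSet A →
      stdGaussian E ((fun z => ‖z‖⁻¹ • z) ⁻¹' A) = σ (Subtype.val ⁻¹' A) * K := by
    intro A hA
    have hmp := (volume : Measure E).measurePreserving_homeomorphUnitSphereProd
    have hA' : MeasurableSet (Subtype.val ⁻¹' A : Set (Metric.sphere (0 : E) 1)) :=
      measurable_subtype_coe hA
    set T := (fun z : E => ‖z‖⁻¹ • z) ⁻¹' A
    have hT : MeasurableSet T := hmeas hA
    set G : Metric.sphere (0 : E) 1 × Set.Ioi (0 : ℝ) → ℝ≥0∞ := fun p =>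
      (Subtype.val ⁻¹' A : Set (Metric.sphere (0 : E) 1)).indicator 1 p.1 * g p.2
    have hind : Measurable
        ((Subtype.val ⁻¹' A : Set (Metric.sphere (0 : E) 1)).indicator (1 : Metric.sphere (0 : E) 1 → ℝ≥0∞)) :=
      measurable_one.indicator hA'
    have hg' : Measurable fun r : Set.Ioi (0 : ℝ) => g r := hg.comp measurable_subtype_coe
    have hG : Measurable G := (hind.comp measurable_fst).mul (hg'.comp measurable_snd)
    calc stdGaussian E T = ∫⁻ z, T.indicator (fun z => g ‖z‖) z := by
          rw [stdGaussian_eq_withDensity, withDensity_apply _ hT, lintegral_indicator hT]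
          rfl
      _ = ∫⁻ z in {0}ᶜ, T.indicator (fun z => g ‖z‖) z := by
          rw [Measure.restrict_eq_self_of_ae_mem]
          simp [ae_iff]
      _ = ∫⁻ z : ({0}ᶜ : Set E), T.indicator (fun z => g ‖z‖) z ∂volume.comap Subtype.val :=
          (lintegral_subtype_comap (measurableSet_singleton _).compl _).symm
      _ = ∫⁻ z : ({0}ᶜ : Set E), G (homeomorphUnitSphereProd E z) ∂volume.comap Subtype.val := by
          refine lintegral_congr fun z => ?_
          by_cases hz : (z : E) ∈ T
          · have : (‖(z : E)‖⁻¹ • (z : E)) ∈ A := hz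
            simp [G, hz, Set.indicator, this]
          · have : (‖(z : E)‖⁻¹ • (z : E)) ∉ A := hz
            simp [G, hz, Set.indicator, this]
      _ = _ := by
          rw [hmp.lintegral_comp hG, lintegral_prod_mul hind.aemeasurable hg'.aemeasurable,
            lintegral_indicator_one hA']
  have hK : σ Set.univ * K = 1 := by
    have h := key Set.univ .univ
    rw [Set.preimage_univ, measure_univ, Set.preimage_univ] at h
    exact h.symm
  have hK' : K = (σ Set.univ)⁻¹ := ENNReal.eq_inv_of_mul_eq_one_left (by rwa [mul_comm])
  ext A hA
  rw [Measure.map_apply hmeas hA, key A hA, sphereUniform,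
    Measure.map_apply measurable_subtype_coe hA, Measure.smul_apply, hK', smul_eq_mul, mul_comm]

theorem isProbabilityMeasure_sphereUniform {n : ℕ} (hn : 1 ≤ n) :
    IsProbabilityMeasure (sphereUniform n) := by
  rw [sphereUniform_eq_map_stdGaussian hn]
  exact Measure.isProbabilityMeasure_map (by fun_prop)

theorem ae_norm_eq_one_sphereUniform (n : ℕ) : ∀ᵐ y ∂sphereUniform n, ‖y‖ = 1 := by
  rw [sphereUniform, ae_map_iff measurable_subtype_coe.aemeasurable
    (measurableSet_eq_fun (by fun_prop) measurable_const)]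
  exact Filter.Eventually.of_forall fun y => by simp

theorem sphereUniform_map_linearIsometryEquiv {n : ℕ} (hn : 1 ≤ n)
    (U : EuclideanSpace ℝ (Fin n) ≃ₗᵢ[ℝ] EuclideanSpace ℝ (Fin n)) :
    (sphereUniform n).map U = sphereUniform n := by
  rw [sphereUniform_eq_map_stdGaussian hn, Measure.map_map (by fun_prop) (by fun_prop)]
  conv_rhs => rw [← stdGaussian_map U, Measure.map_map (by fun_prop) (by fun_prop)]
  congr 1
  ext1 z
  simp

/-- Extend `x` to an orthonormal basis. By rotation invariance all `n` coordinates have the same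
second moment, and these sum to 1. -/
theorem lintegral_inner_sq_sphereUniform_le {n : ℕ} (hn : 1 ≤ n) {x : EuclideanSpace ℝ (Fin n)}
    (hx : ‖x‖ = 1) :
    ∫⁻ y, ENNReal.ofReal (inner ℝ x y ^ 2) ∂sphereUniform n ≤ ENNReal.ofReal (1 / n) := by
  have := isProbabilityMeasure_sphereUniform hn
  let i₀ : Fin n := ⟨0, hn⟩
  obtain ⟨b, hb⟩ := Orthonormal.exists_orthonormalBasis_extension_of_card_eq (𝕜 := ℝ)
    (E := EuclideanSpace ℝ (Fin n)) (ι := Fin n) (by simp) (v := fun _ => x) (s := {i₀}) (by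
      rw [orthonormal_iff_ite]
      rintro ⟨i, rfl⟩ ⟨j, rfl⟩
      simp [hx])
  have hb₀ : b i₀ = x := hb i₀ rfl
  have hsymm : ∀ i, ∫⁻ y, ENNReal.ofReal (inner ℝ (b i) y ^ 2) ∂sphereUniform n =
      ∫⁻ y, ENNReal.ofReal (inner ℝ x y ^ 2) ∂sphereUniform n := by
    intro i
    let U := b.equiv b (Equiv.swap i₀ i)
    have hU : U x = b i := by
      rw [← hb₀, OrthonormalBasis.equiv_apply_basis, Equiv.swap_apply_left]
    conv_lhs => rw [← sphereUniform_map_linearIsometryEquiv hn U, lintegral_map (by fun_prop)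
      (by fun_prop)]
    refine lintegral_congr fun y => ?_
    rw [← hU, LinearIsometryEquiv.inner_map_map]
  have hsum : ∑ i, ∫⁻ y, ENNReal.ofReal (inner ℝ (b i) y ^ 2) ∂sphereUniform n = 1 := by
    rw [← lintegral_finsetSum _ fun i _ => by fun_prop]
    calc _ = ∫⁻ y, 1 ∂sphereUniform n := by
          refine lintegral_congr_ae ?_
          filter_upwards [ae_norm_eq_one_sphereUniform n] with y hy
          rw [← ENNReal.ofReal_sum_of_nonneg fun i _ => sq_nonneg _, b.sum_sq_inner_right, hy]
          simp
      _ = 1 := by simp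
  simp only [hsymm, Finset.sum_const, Finset.card_univ, Fintype.card_fin, nsmul_eq_mul] at hsum
  have hinv : ∫⁻ y, ENNReal.ofReal (inner ℝ x y ^ 2) ∂sphereUniform n = (n : ℝ≥0∞)⁻¹ :=
    ENNReal.eq_inv_of_mul_eq_one_left (by rwa [mul_comm] at hsum)
  rw [hinv, one_div, ENNReal.ofReal_inv_of_pos (by exact_mod_cast hn), ENNReal.ofReal_natCast]

theorem lintegral_abs_inner_sphereUniform_le {n : ℕ} (hn : 1 ≤ n) {x : EuclideanSpace ℝ (Fin n)}
    (hx : ‖x‖ = 1) :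
    ∫⁻ y, ENNReal.ofReal |inner ℝ x y| ∂sphereUniform n ≤ ENNReal.ofReal (1 / √n) := by
  have := isProbabilityMeasure_sphereUniform hn
  have hn0 : (0 : ℝ) < n := by exact_mod_cast hn
  have hs : 0 < √(n : ℝ) := Real.sqrt_pos.2 hn0
  have hs2 : √(n : ℝ) * √n = n := Real.mul_self_sqrt hn0.le
  calc ∫⁻ y, ENNReal.ofReal |inner ℝ x y| ∂sphereUniform n
      ≤ ∫⁻ y, (ENNReal.ofReal (√n / 2) * ENNReal.ofReal (inner ℝ x y ^ 2) +
          ENNReal.ofReal (1 / (2 * √n))) ∂sphereUniform n := by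
        refine lintegral_mono fun y => ?_
        rw [← ENNReal.ofReal_mul (by positivity), ← ENNReal.ofReal_add (by positivity)
          (by positivity)]
        exact ENNReal.ofReal_le_ofReal (abs_le_mul_sq_add hs _)
    _ ≤ ENNReal.ofReal (√n / 2) * ENNReal.ofReal (1 / n) + ENNReal.ofReal (1 / (2 * √n)) := by
        rw [lintegral_add_right _ measurable_const, lintegral_const_mul _ (by fun_prop),
          lintegral_const, measure_univ, mul_one]
        gcongr
        exact lintegral_inner_sq_sphereUniform_le hn hx
    _ = _ := by
        rw [← ENNReal.ofReal_mul (by positivity), ← ENNReal.ofReal_add (by positivity)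
          (by positivity)]
        congr 1
        field_simp
        linarith

/-! ### One row of inner products with fixed unit vectors. -/

/-- The vector `(√n ⟨x_i, y⟩ : i)` of scaled inner products with `y`. -/
noncomputable def innerRow {k n : ℕ} (x : Fin k → EuclideanSpace ℝ (Fin n))
    (y : EuclideanSpace ℝ (Fin n)) : EuclideanSpace ℝ (Fin k) :=
  WithLp.toLp 2 fun i => √(n : ℝ) * inner ℝ (x i) y

theorem measurable_innerRow {k n : ℕ} :
    Measurable fun p : (Fin k → EuclideanSpace ℝ (Fin n)) × EuclideanSpace ℝ (Fin n) =>
      innerRow p.1 p.2 := by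
  unfold innerRow
  fun_prop

/-- Gram–Schmidt on `x` padded with `m` zero vectors; the `x i` may be linearly dependent. -/
theorem exists_orthonormalBasis_lowerTriangular {k m n : ℕ} (hn : n = k + m)
    (x : Fin k → EuclideanSpace ℝ (Fin n)) :
    ∃ b : OrthonormalBasis (Fin k ⊕ Fin m) ℝ (EuclideanSpace ℝ (Fin n)),
      (∀ i j, i < j → inner ℝ (b (Sum.inl j)) (x i) = 0) ∧
        ∀ i l, inner ℝ (b (Sum.inr l)) (x i) = 0 := by
  subst hn
  have h : Module.finrank ℝ (EuclideanSpace ℝ (Fin (k + m))) = Fintype.card (Fin (k + m)) := by simp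
  have hf : ∀ i, Fin.append x (0 : Fin m → EuclideanSpace ℝ (Fin (k + m))) (Fin.castAdd m i) = x i :=
    fun i => Fin.append_left _ _ i
  refine ⟨(InnerProductSpace.gramSchmidtOrthonormalBasis h
    (Fin.append x (0 : Fin m → EuclideanSpace ℝ (Fin (k + m))))).reindex finSumFinEquiv.symm,
    fun i j hij => ?_, fun i l => ?_⟩
  · rw [← hf i, OrthonormalBasis.reindex_apply]
    exact InnerProductSpace.gramSchmidtOrthonormalBasis_inv_triangular h _ hij
  · rw [← hf i, OrthonormalBasis.reindex_apply]
    refine InnerProductSpace.gramSchmidtOrthonormalBasis_inv_triangular h _ ?_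
    simp [Fin.lt_def]
    omega

theorem stdGaussian_le_innerRow_add (k : ℕ) :
    ∃ C : ℝ≥0∞, C ≠ ∞ ∧ ∀ n : ℕ, 1 ≤ n → k ≤ n →
      ∀ x : Fin k → EuclideanSpace ℝ (Fin n), (∀ i, ‖x i‖ = 1) →
        ∀ D : Set (EuclideanSpace ℝ (Fin k)), MeasurableSet D →
          stdGaussian (EuclideanSpace ℝ (Fin k)) D ≤
            sphereUniform n (innerRow x ⁻¹' D) + C * (ENNReal.ofReal (1 / √n) +
              ∑ i, ∑ j, ENNReal.ofReal |inner ℝ (x i) (x j) - (1 : Matrix _ _ ℝ) i j|) := by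
  obtain ⟨C₁, hC₁, h₁⟩ := stdGaussian_le_preimage_matrix_add (Fin k)
  obtain ⟨C₂, hC₂, h₂⟩ := stdGaussian_le_preimage_radialContraction_add (Fin k)
  obtain ⟨C₃, hC₃, h₃⟩ := lintegral_abs_norm_sq_div_sub_one_le k
  refine ⟨C₂ * (C₃ + 1) + C₁, by finiteness, fun n hn hkn x hx D hD => ?_⟩
  obtain ⟨m, hkm⟩ := Nat.exists_eq_add_of_le hkn
  have h₃ := h₃ m (hkm ▸ hn)
  rw [← hkm] at h₃
  obtain ⟨b, hb₁, hb₂⟩ := exists_orthonormalBasis_lowerTriangular hkm x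
  set L : Matrix (Fin k) (Fin k) ℝ := .of fun i j => inner ℝ (b (Sum.inl j)) (x i) with hL
  have hgram : ∀ i j, (L * Lᵀ) i j = inner ℝ (x i) (x j) := by
    intro i j
    rw [← b.sum_inner_mul_inner (x i) (x j), Fintype.sum_sum_type]
    simp [hL, Matrix.mul_apply, hb₂, real_inner_comm]
  have hdet : |L.det| ≤ 1 := by
    refine Matrix.abs_det_le_one_of_lowerTriangular (fun i j hij => hb₁ i j hij) fun i => ?_
    have h := hgram i i
    rw [real_inner_self_eq_norm_sq, hx i, one_pow] at h
    rw [← h, Matrix.mul_apply]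
    exact Finset.sum_congr rfl fun j _ => sq _
  have hn0 : (0 : ℝ) < n := by exact_mod_cast hn
  set A := Matrix.toEuclideanCLM (𝕜 := ℝ) L ⁻¹' D
  have hA : MeasurableSet A := (Matrix.toEuclideanCLM (𝕜 := ℝ) L).measurable hD
  set γk := stdGaussian (EuclideanSpace ℝ (Fin k))
  set γm := stdGaussian (EuclideanSpace ℝ (Fin m))
  set Z : EuclideanSpace ℝ (Fin k) × EuclideanSpace ℝ (Fin m) → EuclideanSpace ℝ (Fin n) :=
    fun p => ∑ i, p.1 i • b (Sum.inl i) + ∑ j, p.2 j • b (Sum.inr j) with hZ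
  have hZm : Measurable Z := by fun_prop
  have hnorm : ∀ p, ‖Z p‖ = √(‖p.1‖ ^ 2 + ‖p.2‖ ^ 2) := by
    intro p
    have h : Z p = b.repr.symm (WithLp.toLp 2 (Sum.elim p.1 p.2)) := by
      rw [← b.sum_repr_symm, Fintype.sum_sum_type]
      rfl
    rw [h, LinearIsometryEquiv.norm_map, EuclideanSpace.norm_eq, Fintype.sum_sum_type]
    simp [EuclideanSpace.real_norm_sq_eq]
  have hinner : ∀ p i, inner ℝ (x i) (Z p) = (L *ᵥ p.1.ofLp) i := by
    intro p i
    have hb₃ : ∀ l, inner ℝ (x i) (b (Sum.inr l)) = 0 := fun l => by rw [real_inner_comm, hb₂]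
    simp [hZ, inner_add_right, inner_sum, inner_smul_right, hL, Matrix.mulVec, dotProduct,
      real_inner_comm, hb₃, mul_comm]
  -- The key identity: the row is `L` applied to the radial contraction of `z`, with `ρ = ‖w‖`
  -- independent of `z`.
  have hrow : ∀ p, innerRow x (‖Z p‖⁻¹ • Z p) =
      Matrix.toEuclideanCLM (𝕜 := ℝ) L (radialContraction n ‖p.2‖ p.1) := by
    intro p
    ext i
    rw [radialContraction, map_smul, PiLp.smul_apply, Matrix.ofLp_toEuclideanCLM, smul_eq_mul]
    change √(n : ℝ) * inner ℝ (x i) (‖Z p‖⁻¹ • Z p) = _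
    rw [real_inner_smul_right, hinner, hnorm]
    ring
  have hinnerRow : Measurable (innerRow x) := measurable_innerRow.comp measurable_prodMk_left
  have hcomp : Measurable fun p => innerRow x (‖Z p‖⁻¹ • Z p) := by fun_prop
  have hsphere : sphereUniform n (innerRow x ⁻¹' D) =
      ∫⁻ w, γk (radialContraction n ‖w‖ ⁻¹' A) ∂γm := by
    rw [sphereUniform_eq_map_stdGaussian hn, ← stdGaussian_prod_map_orthonormalBasis b,
      Measure.map_map (by fun_prop) hZm, Measure.map_apply (by fun_prop) (hinnerRow hD)]
    refine (Measure.prod_apply_symm (hcomp hD)).trans ?_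
    refine lintegral_congr fun w => ?_
    congr 1
    ext z
    simp only [Set.mem_preimage, A]
    rw [← hrow (z, w)]
  have hγA : γk A ≤ sphereUniform n (innerRow x ⁻¹' D) +
      C₂ * (C₃ + 1) * ENNReal.ofReal (1 / √n) := by
    have hle : ENNReal.ofReal (1 / n) ≤ ENNReal.ofReal (1 / √n) := by
      refine ENNReal.ofReal_le_ofReal (one_div_le_one_div_of_le (by positivity) ?_)
      rw [Real.sqrt_le_left (by positivity)]
      have : (1 : ℝ) ≤ n := by exact_mod_cast hn
      nlinarith
    -- The radial comparison holds for each fixed `w`; averaging over `w` brings in the mean of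
    -- `|‖w‖²/n - 1|`.
    calc γk A = ∫⁻ _, γk A ∂γm := by simp
      _ ≤ ∫⁻ w, (γk (radialContraction n ‖w‖ ⁻¹' A) +
            C₂ * (ENNReal.ofReal |‖w‖ ^ 2 / n - 1| + ENNReal.ofReal (1 / n))) ∂γm :=
          lintegral_mono fun w => h₂ n hn0 ‖w‖ (norm_nonneg _) A hA
      _ = sphereUniform n (innerRow x ⁻¹' D) + C₂ * ((∫⁻ w, ENNReal.ofReal |‖w‖ ^ 2 / n - 1| ∂γm) +
            ENNReal.ofReal (1 / n)) := by
          rw [lintegral_add_right _ (by fun_prop), lintegral_const_mul _ (by fun_prop),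
            lintegral_add_right _ (by fun_prop), hsphere]
          simp
      _ ≤ sphereUniform n (innerRow x ⁻¹' D) + C₂ * (C₃ * ENNReal.ofReal (1 / √n) +
            ENNReal.ofReal (1 / √n)) :=
          add_le_add_right (mul_le_mul_right (add_le_add h₃ hle) _) _
      _ = _ := by ring
  have hsum : ENNReal.ofReal (∑ i, ∑ j, |(L * Lᵀ - 1) i j|) =
      ∑ i, ∑ j, ENNReal.ofReal |inner ℝ (x i) (x j) - (1 : Matrix _ _ ℝ) i j| := by
    simp only [Matrix.sub_apply, hgram]
    rw [ENNReal.ofReal_sum_of_nonneg fun i _ => Finset.sum_nonneg fun j _ => abs_nonneg _]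
    exact Finset.sum_congr rfl fun i _ => ENNReal.ofReal_sum_of_nonneg fun j _ => abs_nonneg _
  calc γk D ≤ γk A + C₁ * ENNReal.ofReal (∑ i, ∑ j, |(L * Lᵀ - 1) i j|) := h₁ L hdet D hD
    _ ≤ sphereUniform n (innerRow x ⁻¹' D) + C₂ * (C₃ + 1) * ENNReal.ofReal (1 / √n) +
          C₁ * ENNReal.ofReal (∑ i, ∑ j, |(L * Lᵀ - 1) i j|) := add_le_add_left hγA _
    _ ≤ _ := by
      rw [hsum, add_assoc, mul_add (C₂ * (C₃ + 1) + C₁)]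
      exact add_le_add_right
        (add_le_add (mul_le_mul_left le_self_add _) (mul_le_mul_left le_add_self _)) _

/-! ### Induction on the number of vectors. -/

/-- The pairs `i < j` in `{1, …, r + 1}` are the pairs in `{1, …, r}` and the pairs
`(i, r + 1)`. -/
noncomputable def orderedPairSuccEquiv (r : ℕ) : OrderedPair r ⊕ Fin r ≃ OrderedPair (r + 1) :=
  Equiv.ofBijective
    (Sum.elim (fun p => ⟨(p.1.1.castSucc, p.1.2.castSucc), by simpa using p.2⟩)
      fun i => ⟨(i.castSucc, Fin.last r), Fin.castSucc_lt_last i⟩) <| by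
    constructor
    · rintro (⟨⟨i, j⟩, h⟩ | i) (⟨⟨i', j'⟩, h'⟩ | i') heq <;>
        simp [Fin.ext_iff] at heq ⊢ <;> omega
    · rintro ⟨⟨i, j⟩, h⟩
      obtain ⟨i, rfl⟩ := Fin.exists_castSucc_eq.2 (Fin.ne_last_of_lt h)
      induction j using Fin.lastCases with
      | last => exact ⟨Sum.inr i, rfl⟩
      | cast j => exact ⟨Sum.inl ⟨(i, j), by simpa using h⟩, rfl⟩

theorem orderedPairSuccEquiv_inl {r : ℕ} (p : OrderedPair r) :
    (orderedPairSuccEquiv r (Sum.inl p)).1 = (p.1.1.castSucc, p.1.2.castSucc) := rfl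

theorem orderedPairSuccEquiv_inr {r : ℕ} (i : Fin r) :
    (orderedPairSuccEquiv r (Sum.inr i)).1 = (i.castSucc, Fin.last r) := rfl

/-- Concatenation of the vectors indexed by the two parts of `OrderedPair (r + 1)`. -/
noncomputable def joinPairs {r : ℕ}
    (p : EuclideanSpace ℝ (OrderedPair r) × EuclideanSpace ℝ (Fin r)) :
    EuclideanSpace ℝ (OrderedPair (r + 1)) :=
  WithLp.toLp 2 fun l => Sum.elim p.1 p.2 ((orderedPairSuccEquiv r).symm l)

theorem joinPairs_eq_sum {r : ℕ}
    (p : EuclideanSpace ℝ (OrderedPair r) × EuclideanSpace ℝ (Fin r)) :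
    joinPairs p = ∑ i, p.1 i • (EuclideanSpace.basisFun (OrderedPair (r + 1)) ℝ).reindex
        (orderedPairSuccEquiv r).symm (Sum.inl i) +
      ∑ j, p.2 j • (EuclideanSpace.basisFun (OrderedPair (r + 1)) ℝ).reindex
        (orderedPairSuccEquiv r).symm (Sum.inr j) := by
  ext l
  obtain ⟨s, rfl⟩ := (orderedPairSuccEquiv r).surjective l
  rcases s with s | s <;> simp [joinPairs, Pi.single_apply]

theorem measurable_joinPairs {r : ℕ} : Measurable (joinPairs (r := r)) := by
  have : joinPairs (r := r) = _ := funext joinPairs_eq_sum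
  rw [this]
  fun_prop

theorem stdGaussian_prod_map_joinPairs (r : ℕ) :
    ((stdGaussian (EuclideanSpace ℝ (OrderedPair r))).prod
      (stdGaussian (EuclideanSpace ℝ (Fin r)))).map joinPairs =
      stdGaussian (EuclideanSpace ℝ (OrderedPair (r + 1))) := by
  rw [← stdGaussian_prod_map_orthonormalBasis ((EuclideanSpace.basisFun
    (OrderedPair (r + 1)) ℝ).reindex (orderedPairSuccEquiv r).symm)]
  congr 1
  exact funext joinPairs_eq_sum

theorem measurable_scaledInnerProducts {r n : ℕ} :
    Measurable (scaledInnerProducts (r := r) (n := n)) := by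
  unfold scaledInnerProducts
  fun_prop

theorem scaledInnerProducts_snoc {r n : ℕ} (x : Fin r → EuclideanSpace ℝ (Fin n))
    (y : EuclideanSpace ℝ (Fin n)) :
    scaledInnerProducts (Fin.snoc x y : Fin (r + 1) → EuclideanSpace ℝ (Fin n)) =
      joinPairs (scaledInnerProducts x, innerRow x y) := by
  ext l
  obtain ⟨s, rfl⟩ := (orderedPairSuccEquiv r).surjective l
  simp only [scaledInnerProducts, joinPairs, Equiv.symm_apply_apply]
  rcases s with s | s <;> simp [orderedPairSuccEquiv_inl, orderedPairSuccEquiv_inr, innerRow]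

/-- Diagonal terms vanish almost surely; an off-diagonal term pairs two independent uniform points.
-/
theorem lintegral_gram_sub_one_le {n : ℕ} (hn : 1 ≤ n) (r : ℕ) :
    ∫⁻ x : Fin r → EuclideanSpace ℝ (Fin n), ∑ i, ∑ j,
        ENNReal.ofReal |inner ℝ (x i) (x j) - (1 : Matrix (Fin r) (Fin r) ℝ) i j|
        ∂Measure.pi (fun _ => sphereUniform n) ≤ (r * r) * ENNReal.ofReal (1 / √n) := by
  have := isProbabilityMeasure_sphereUniform hn
  set ν := Measure.pi (fun _ : Fin r => sphereUniform n)
  rw [lintegral_finsetSum _ fun i _ => by fun_prop]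
  have key : ∀ i j, ∫⁻ x : Fin r → EuclideanSpace ℝ (Fin n),
      ENNReal.ofReal |inner ℝ (x i) (x j) - (1 : Matrix (Fin r) (Fin r) ℝ) i j| ∂ν ≤
        ENNReal.ofReal (1 / √n) := by
    intro i j
    rcases eq_or_ne i j with rfl | hij
    · have hae : ∀ᵐ x ∂ν, ‖x i‖ = 1 := (measurePreserving_eval (fun _ : Fin r => sphereUniform n)
        i).quasiMeasurePreserving.ae (ae_norm_eq_one_sphereUniform n)
      rw [lintegral_congr_ae (g := fun _ => 0)]
      · simp
      · filter_upwards [hae] with x hx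
        simp [hx]
    · have hind : IndepFun (fun x : Fin r → EuclideanSpace ℝ (Fin n) => x i) (fun x => x j) ν :=
        (iIndepFun_pi (μ := fun _ : Fin r => sphereUniform n) (X := fun _ y => y)
          fun _ => aemeasurable_id).indepFun hij
      rw [indepFun_iff_map_prod_eq_prod_map_map (measurable_pi_apply i).aemeasurable
        (measurable_pi_apply j).aemeasurable,
        (measurePreserving_eval (fun _ : Fin r => sphereUniform n) i).map_eq,
        (measurePreserving_eval (fun _ : Fin r => sphereUniform n) j).map_eq] at hind
      calc _ = ∫⁻ x, ENNReal.ofReal |inner ℝ (x i) (x j)| ∂ν := by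
            simp [Matrix.one_apply_ne hij]
        _ = ∫⁻ p : EuclideanSpace ℝ (Fin n) × EuclideanSpace ℝ (Fin n),
              ENNReal.ofReal |inner ℝ p.1 p.2| ∂(sphereUniform n).prod (sphereUniform n) := by
            rw [← hind, lintegral_map (by fun_prop) (by fun_prop)]
        _ = ∫⁻ x, ∫⁻ y, ENNReal.ofReal |inner ℝ x y| ∂sphereUniform n ∂sphereUniform n :=
            lintegral_prod _ (by fun_prop)
        _ ≤ ∫⁻ _, ENNReal.ofReal (1 / √n) ∂sphereUniform n := by
            refine lintegral_mono_ae ?_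
            filter_upwards [ae_norm_eq_one_sphereUniform n] with x hx
            exact lintegral_abs_inner_sphereUniform_le hn hx
        _ = _ := by simp
  calc _ ≤ ∑ _i : Fin r, ∑ _j : Fin r, ENNReal.ofReal (1 / √n) := by
        refine Finset.sum_le_sum fun i _ => ?_
        rw [lintegral_finsetSum _ fun j _ => by fun_prop]
        exact Finset.sum_le_sum fun j _ => key i j
    _ = _ := by simp [mul_assoc]

theorem stdGaussian_le_map_scaledInnerProducts_add (r : ℕ) :
    ∃ C : ℝ≥0∞, C ≠ ∞ ∧ ∀ n : ℕ, 1 ≤ n →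
      ∀ D : Set (EuclideanSpace ℝ (OrderedPair r)), MeasurableSet D →
        stdGaussian (EuclideanSpace ℝ (OrderedPair r)) D ≤
          (Measure.pi fun _ : Fin r => sphereUniform n).map scaledInnerProducts D +
            C * ENNReal.ofReal (1 / √n) := by
  induction r with
  | zero =>
    refine ⟨0, ENNReal.zero_ne_top, fun n hn D hD => ?_⟩
    have := isProbabilityMeasure_sphereUniform hn
    have : IsProbabilityMeasure ((Measure.pi fun _ : Fin 0 => sphereUniform n).map
        scaledInnerProducts) :=
      Measure.isProbabilityMeasure_map measurable_scaledInnerProducts.aemeasurable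
    rcases Set.eq_empty_or_nonempty D with rfl | hne
    · simp
    · rw [hne.eq_univ]
      simp
  | succ r ih =>
    obtain ⟨C₁, hC₁, h₁⟩ := ih
    obtain ⟨C₂, hC₂, h₂⟩ := stdGaussian_le_innerRow_add r
    -- `C₁` is the error for the first `r` vectors and `C₂ * (1 + r * r)` that of the new row; `√r`
    -- makes the bound trivial when `n < r`, where the row comparison is not available.
    refine ⟨C₁ + C₂ * (1 + r * r) + ENNReal.ofReal √r, by finiteness, fun n hn D hD => ?_⟩
    have := isProbabilityMeasure_sphereUniform hn
    rcases lt_or_ge n r with hnr | hrn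
    · calc stdGaussian (EuclideanSpace ℝ (OrderedPair (r + 1))) D ≤ 1 := prob_le_one
        _ ≤ ENNReal.ofReal √r * ENNReal.ofReal (1 / √n) := by
          rw [← ENNReal.ofReal_mul (by positivity), ← ENNReal.ofReal_one]
          refine ENNReal.ofReal_le_ofReal ?_
          have : (0 : ℝ) < n := by exact_mod_cast hn
          rw [mul_one_div, one_le_div (by positivity)]
          gcongr
        _ ≤ (C₁ + C₂ * (1 + r * r) + ENNReal.ofReal √r) * ENNReal.ofReal (1 / √n) :=
          mul_le_mul_left le_add_self _
        _ ≤ _ := le_add_self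
    set ν := Measure.pi fun _ : Fin r => sphereUniform n
    set γ := stdGaussian (EuclideanSpace ℝ (OrderedPair r))
    set γr := stdGaussian (EuclideanSpace ℝ (Fin r))
    set f : EuclideanSpace ℝ (OrderedPair r) → ℝ≥0∞ := fun u =>
      γr (Prod.mk u ⁻¹' (joinPairs ⁻¹' D))
    have hJD : MeasurableSet (joinPairs (r := r) ⁻¹' D) := measurable_joinPairs hD
    have hf : Measurable f := measurable_measure_prodMk_left hJD
    have hγ : stdGaussian (EuclideanSpace ℝ (OrderedPair (r + 1))) D = ∫⁻ u, f u ∂γ := by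
      rw [← stdGaussian_prod_map_joinPairs, Measure.map_apply measurable_joinPairs hD,
        Measure.prod_apply hJD]
    have hpi : (Measure.pi fun _ : Fin (r + 1) => sphereUniform n).map scaledInnerProducts D =
        ∫⁻ x, sphereUniform n (innerRow x ⁻¹' (Prod.mk (scaledInnerProducts x) ⁻¹'
          (joinPairs ⁻¹' D))) ∂ν := by
      -- The splitting puts the last vector in the first factor, hence `Measure.prod_apply_symm`
      -- below.
      have hmp := (measurePreserving_piFinSuccAbove (fun _ : Fin (r + 1) => sphereUniform n)
        (Fin.last r)).symm
      rw [← hmp.map_eq, Measure.map_map measurable_scaledInnerProducts hmp.measurable,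
        Measure.map_apply (measurable_scaledInnerProducts.comp hmp.measurable) hD,
        Measure.prod_apply_symm ((measurable_scaledInnerProducts.comp hmp.measurable) hD)]
      refine lintegral_congr fun x => ?_
      congr 1
      ext y
      have : (MeasurableEquiv.piFinSuccAbove (fun _ => EuclideanSpace ℝ (Fin n))
          (Fin.last r)).symm (y, x) = Fin.snoc x y := by
        simp [MeasurableEquiv.piFinSuccAbove]
        rfl
      simp only [Set.mem_preimage, Function.comp_apply]
      rw [← scaledInnerProducts_snoc, ← this]
    have hae : ∀ᵐ x ∂ν, ∀ i, ‖x i‖ = 1 := ae_all_iff.2 fun i =>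
      (measurePreserving_eval (fun _ : Fin r => sphereUniform n)
        i).quasiMeasurePreserving.ae (ae_norm_eq_one_sphereUniform n)
    have hpre : Measurable fun x : Fin r → EuclideanSpace ℝ (Fin n) =>
        ∑ i, ∑ j, ENNReal.ofReal |inner ℝ (x i) (x j) - (1 : Matrix (Fin r) (Fin r) ℝ) i j| := by
      fun_prop
    set δ := ENNReal.ofReal (1 / √n)
    calc stdGaussian (EuclideanSpace ℝ (OrderedPair (r + 1))) D = ∫⁻ u, f u ∂γ := hγ
      _ ≤ (∫⁻ u, f u ∂ν.map scaledInnerProducts) + C₁ * δ :=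
        lintegral_le_lintegral_add_of_forall_le_add (h₁ n hn) hf fun u => prob_le_one
      _ = (∫⁻ x, f (scaledInnerProducts x) ∂ν) + C₁ * δ := by
        rw [lintegral_map hf measurable_scaledInnerProducts]
      _ ≤ (∫⁻ x, (sphereUniform n (innerRow x ⁻¹' (Prod.mk (scaledInnerProducts x) ⁻¹'
            (joinPairs ⁻¹' D))) + C₂ * (δ + ∑ i, ∑ j, ENNReal.ofReal
              |inner ℝ (x i) (x j) - (1 : Matrix (Fin r) (Fin r) ℝ) i j|)) ∂ν) + C₁ * δ := by
        refine add_le_add_left (lintegral_mono_ae ?_) _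
        filter_upwards [hae] with x hx
        -- The section of `D` depends on `x`, which is harmless because the row bound is uniform
        -- over measurable sets.
        exact h₂ n hn hrn x hx _ (measurable_prodMk_left hJD)
      _ ≤ (Measure.pi fun _ : Fin (r + 1) => sphereUniform n).map scaledInnerProducts D +
            C₂ * (δ + r * r * δ) + C₁ * δ := by
        rw [lintegral_add_right _ (by fun_prop), lintegral_const_mul _ (by fun_prop),
          lintegral_add_left measurable_const, hpi, lintegral_const, measure_univ, mul_one]
        gcongr
        exact lintegral_gram_sub_one_le hn r
      _ = (Measure.pi fun _ : Fin (r + 1) => sphereUniform n).map scaledInnerProducts D +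
            (C₁ + C₂ * (1 + r * r)) * δ := by ring
      _ ≤ _ := add_le_add_right (mul_le_mul_left le_self_add _) _

theorem lemma7 (r : ℕ) :
    ∃ C : ℝ, ∀ (n : ℕ), 1 ≤ n →
      ∀ (Ω : Type*) [MeasurableSpace Ω] (P : Measure Ω) [IsProbabilityMeasure P]
        (X : Fin r → Ω → EuclideanSpace ℝ (Fin n)),
        (∀ i, HasLaw (X i) (sphereUniform n) P) → iIndepFun X P →
        tvDist (P.map fun ω => scaledInnerProducts fun i => X i ω)
            (multivariateGaussian (0 : EuclideanSpace ℝ (OrderedPair r))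
              (1 : Matrix (OrderedPair r) (OrderedPair r) ℝ))
          ≤ C / √(n : ℝ) := by
  obtain ⟨C, hC, h⟩ := stdGaussian_le_map_scaledInnerProducts_add r
  refine ⟨C.toReal, fun n hn Ω _ P _ X hX hind => ?_⟩
  have hXm : AEMeasurable (fun ω i => X i ω) P := aemeasurable_pi_lambda _ fun i => (hX i).aemeasurable
  have hlaw : P.map (fun ω => scaledInnerProducts fun i => X i ω) =
      (Measure.pi fun _ : Fin r => sphereUniform n).map scaledInnerProducts := by
    have h₁ := (iIndepFun_iff_map_fun_eq_pi_map fun i => (hX i).aemeasurable).1 hind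
    simp only [(hX _).map_eq] at h₁
    rw [← h₁, AEMeasurable.map_map_of_aemeasurable measurable_scaledInnerProducts.aemeasurable hXm]
    rfl
  have : IsProbabilityMeasure (P.map fun ω => scaledInnerProducts fun i => X i ω) :=
    Measure.isProbabilityMeasure_map (measurable_scaledInnerProducts.comp_aemeasurable hXm)
  rw [multivariateGaussian_zero_one]
  refine tvDist_le_of_forall_le_add (by positivity) fun D hD => ?_
  rw [hlaw, div_eq_mul_one_div, ENNReal.ofReal_mul ENNReal.toReal_nonneg, ENNReal.ofReal_toReal hC]
  exact h n hn D hD
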